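/- Let $R_{\max}>0$, let $\mathcal A\subset\mathbb R^2$ be the disc of radius $R_{\max}$ centred at the origin, and let the base stations (BSs) form a homogeneous Poisson point process of density $\lambda_b>0$ on $\mathcal A$. A user is located at a point $u\in\mathcal A$ at distance $r$ from the origin, $0\le r\le R_{\max}$. Given the BS locations, the links from the user to the BSs are, independently of each other, non-line-of-sight (NLOS), a link of length $l$ with probability $$p_B(l)=1-e^{-\lambda\,(l-r_B)^+\,r_B},\qquad \lambda=\lambda_b+\lambda_u+\lambda_e,$$ where $\lambda_u,\lambda_e\ge 0$ are the densities of the users and of the external blockers and $r_B>0$ is the radius of the blockers. Let $r_0$ be the communication range, and assume $r_B<r_0$ and $r_B<R_{\max}$. For $R_{\max}-r<l<R_{\max}+r$ put $$\delta=\tfrac14\sqrt{(r+R_{\max}+l)(r+R_{\max}-l)(r-R_{\max}+l)(-r+R_{\max}+l)},$$ $$x_{1,2}=\pm\frac{2\delta}{r},\qquad y=\frac r2+\frac{R_{\max}^2-l^2}{2r},\qquad m_1=\frac{y-r}{x_1},\qquad m_2=\frac{y-r}{x_2},$$ $$\theta(l,r)=\pi+\arctan m_1-\arctan m_2,\qquad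 C(l,r)=\theta(l,r)\,l,$$ and put $C(l,r)=0$ for $l\ge R_{\max}+r$. Then, for every $l>R_{\max}-r$, $C(l,r)$ is the length of the part of the circle of radius $l$ around the user that lies in $\mathcal A$; moreover, for $R_{\max}-r<l<R_{\max}+r$, $\tan\theta(l,r)=\frac{m_1-m_2}{1+m_1m_2}$ whenever $1+m_1m_2\neq0$. The probability that there is at least one NLOS BS within distance $r_0$ of the user is $B_N>0$, where $$B_N=\begin{cases}1-\exp\Big(-2\pi\lambda_b\int_0^{r_0}v\,p_B(v)\,dv\Big), & r\le R_{\max}-r_0,\\[1ex] 1-\exp\Big(-\lambda_b\Big(2\pi\int_0^{R_{\max}-r}v\,p_B(v)\,dv+\int_{R_{\max}-r}^{r_0}C(v,r)\,p_B(v)\,dv\Big)\Big), & \text{otherwise.}\end{cases}$$ Conditionally on this event, the distance from the user to the nearest NLOS BS has on $[0,r_0]$ the (nonnegative) probability density $l\mapsto f_N(l,r)$ with respect to Lebesgue measure, where $$f_N(l,r)=\begin{cases}\dfrac{2\pi l\lambda_b\,p_B(l)}{B_N}\exp\Big(-2\pi\lambda_b\int_0^{l}v\,p_B(v)\,dv\Big),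 & r\le R_{\max}-r_0\ \text{or}\ l\le R_{\max}-r,\\[2ex] \dfrac{\lambda_b\,C(l,r)\,p_B(l)}{B_N}\exp\Big(-\lambda_b\Big(2\pi\int_0^{R_{\max}-r}v\,p_B(v)\,dv+\int_{R_{\max}-r}^{l}C(v,r)\,p_B(v)\,dv\Big)\Big), & \text{otherwise.}\end{cases}$$ -/

import Mathlib

open MeasureTheory ProbabilityTheory

noncomputable section

namespace MmWave

/-- The Euclidean plane. -/
abbrev Plane : Type := EuclideanSpace ℝ (Fin 2)

/-! ### Point processes with finitely many points -/

section PointProcess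

variable {Ω E : Type*} [MeasurableSpace Ω] [MeasurableSpace E]

/-- The number of points in `B` of the random finite configuration
`X 0 ω, …, X (K ω - 1) ω`. -/
def pointCount (K : Ω → ℕ) (X : ℕ → Ω → E) (B : Set E) (ω : Ω) : ℕ :=
  {i : ℕ | i < K ω ∧ X i ω ∈ B}.ncard

/-- The random finite configuration `X 0, …, X (K - 1)` is a Poisson point process with
(finite) intensity measure `Λ`: counts are Poisson distributed, and counts in pairwise disjoint
sets are independent. The values `X i ω` with `K ω ≤ i` play no role. -/
structure IsPoissonPointProcess (K : Ω → ℕ) (X : ℕ → Ω → E) (Λ : Measure E)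
    (P : Measure Ω) : Prop where
  measurable_num : Measurable K
  measurable_point : ∀ i, Measurable (X i)
  count_law : ∀ B : Set E, MeasurableSet B →
    HasLaw (pointCount K X B) (poissonMeasure (Λ B).toNNReal) P
  count_indep : ∀ (n : ℕ) (B : Fin n → Set E), (∀ j, MeasurableSet (B j)) →
    Pairwise (fun j k => Disjoint (B j) (B k)) →
    iIndepFun (fun j => pointCount K X (B j)) P

/-- The σ-algebra generated by the configuration. -/
abbrev configSigma (K : Ω → ℕ) (X : ℕ → Ω → E) : MeasurableSpace Ω :=
  MeasurableSpace.comap (fun ω => (K ω, fun i => X i ω)) inferInstance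

/-- The events `Z i` ("the `i`-th point is marked") form an independent marking of the
configuration with location dependent probability `p`: conditionally on the
configuration, the points are marked independently of each other, a point at `x` with
probability `p x`. Only the marks of the actual points, `i < K`, matter. -/
structure IsIndependentMarking (K : Ω → ℕ) (X : ℕ → Ω → E) (Z : ℕ → Set Ω) (p : E → ℝ)
    (P : Measure Ω) : Prop where
  measurableSet_mark : ∀ i, MeasurableSet (Z i)
  condExp_marks : ∀ S : Finset ℕ,
    P[(⋂ i ∈ S, ({ω | i < K ω} ∩ Z i)).indicator (fun _ => (1 : ℝ)) | configSigma K X]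
      =ᵐ[P] fun ω => ∏ i ∈ S, if i < K ω then p (X i ω) else 0

end PointProcess

/-! ### Nearest marked (NLOS) base station -/

section Nearest

variable {Ω : Type*}

/-- The event that some marked point lies within distance `r₀` of `u`. -/
def markedInRange (K : Ω → ℕ) (X : ℕ → Ω → Plane) (Z : ℕ → Set Ω) (u : Plane) (r₀ : ℝ) :
    Set Ω :=
  {ω | ∃ i, i < K ω ∧ ω ∈ Z i ∧ dist (X i ω) u ≤ r₀}

/-- The distance from `u` to the nearest marked point (only used on the event that there is a
marked point). -/
def nearestMarkedDist (K : Ω → ℕ) (X : ℕ → Ω → Plane) (Z : ℕ → Set Ω) (u : Plane) (ω : Ω) : ℝ :=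
  sInf {d : ℝ | ∃ i, i < K ω ∧ ω ∈ Z i ∧ d = dist (X i ω) u}

end Nearest

/-! ### Blockage probability -/

/-- Blockage probability `1 - exp (-lam (l - rB) rB)` of a link of length `l`, where `lam` is the
total density of blockers; a link shorter than the blocker radius `rB` is not blocked. -/
def pB (lam rB l : ℝ) : ℝ := 1 - Real.exp (-lam * max (l - rB) 0 * rB)

/-! ### Geometry: the circle of radius `l` around a user at distance `r` from the centre of the
disc of radius `R`. The user sits at `(0, r)`; `(x₁, y), (x₂, y)` are the points where the two
circles meet and `m₁, m₂` the slopes of the lines joining them to the user. -/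

def heronArea (R l r : ℝ) : ℝ :=
  Real.sqrt ((r + R + l) * (r + R - l) * (r - R + l) * (-r + R + l)) / 4

def x₁ (R l r : ℝ) : ℝ := 2 * heronArea R l r / r

def x₂ (R l r : ℝ) : ℝ := -(2 * heronArea R l r / r)

def yInter (R l r : ℝ) : ℝ := r / 2 + (R ^ 2 - l ^ 2) / (2 * r)

def m₁ (R l r : ℝ) : ℝ := (yInter R l r - r) / x₁ R l r

def m₂ (R l r : ℝ) : ℝ := (yInter R l r - r) / x₂ R l r

/-- The angle under which the user sees the part of its circle of radius `l > R - r` that lies in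
the disc: the branch `π + arctan m₁ - arctan m₂` of `tan⁻¹ ((m₁ - m₂) / (1 + m₁ m₂))`, and `0` once
the circle surrounds the disc. -/
def arcAngle (R l r : ℝ) : ℝ :=
  if l < R + r then Real.pi + Real.arctan (m₁ R l r) - Real.arctan (m₂ R l r) else 0

/-- `C(l, r) = θ(l, r) l`. -/
def arcC (R l r : ℝ) : ℝ := arcAngle R l r * l

/-- The length of the part of the circle of centre `u` and radius `l` that lies in the disc of
radius `R` around the origin. -/
def circleLengthInDisc (R l : ℝ) (u : Plane) : ℝ :=
  l * (volume {φ : ℝ | φ ∈ Set.Ioc (-Real.pi) Real.pi ∧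
    u + l • (!₂[Real.cos φ, Real.sin φ] : Plane) ∈ Metric.closedBall (0 : Plane) R}).toReal

/-! ### The closed formulas -/

/-- The probability `B_N`, for base station density `lb` and blockage probability `p`. -/
def BN (lb R r₀ : ℝ) (p : ℝ → ℝ) (r : ℝ) : ℝ :=
  if r ≤ R - r₀ then
    1 - Real.exp (-(2 * Real.pi * lb * ∫ v in (0 : ℝ)..r₀, v * p v))
  else
    1 - Real.exp (-(lb * (2 * Real.pi * (∫ v in (0 : ℝ)..(R - r), v * p v)
      + ∫ v in (R - r)..r₀, arcC R v r * p v)))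

/-- The density `f_N(l, r)`. -/
def fN (lb R r₀ : ℝ) (p : ℝ → ℝ) (l r : ℝ) : ℝ :=
  if r ≤ R - r₀ ∨ l ≤ R - r then
    2 * Real.pi * l * lb * p l *
      Real.exp (-(2 * Real.pi * lb * ∫ v in (0 : ℝ)..l, v * p v)) / BN lb R r₀ p r
  else
    lb * arcC R l r * p l *
      Real.exp (-(lb * (2 * Real.pi * (∫ v in (0 : ℝ)..(R - r), v * p v)
        + ∫ v in (R - r)..l, arcC R v r * p v))) / BN lb R r₀ p r

end MmWave

end

namespace MmWave

/-! Everything follows from void probabilities. Given the configuration, no marked point lies in `B`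
with probability `∏ (1 - 1_B p)(X i)`. The mean of this product is the Poisson generating functional
at `1 - 1_B p`, which equals `exp (-∫_B p dΛ)` (`IsPoissonPointProcess.measureReal_noMarkedIn`).

For `B` the ball of radius `t` around the user, polar coordinates turn the exponent into `∫₀ᵗ h`
with `h v = lb * circleLengthInDisc R v u * p v` (`integral_ball_disc`). So the nearest marked
distance has hazard rate `h`: its distribution function on `[0, r₀]` is `1 - exp (-∫₀ᵗ h)` before
conditioning. Its density there is `h exp (-∫ h)`, and conditioning divides by the value `B_N` of
that function at `r₀` (`map_nearestMarkedDist_cond`).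

The two cases in the closed formulas only record that the circle is entire, of length `2πv`, for `v
≤ R - r`, and is an arc or empty beyond (`BN_eq`, `fN_eq`). For the arc, with `k = interCos R l r`,
the law of cosines says that a direction at angle `φ` from the outward one stays in the disc iff
`cos φ ≤ k`. These directions have measure `2π - 2 arccos k = π + 2 arcsin k`, and `arcsin k =
arctan m₁ = -arctan m₂` (`arcC_eq_circleLengthInDisc`). -/

lemma pointCount_eq_card {Ω E : Type*} (K : Ω → ℕ) (X : ℕ → Ω → E) (B : Set E) (ω : Ω)
    [DecidablePred fun i => X i ω ∈ B] :
    pointCount K X B ω = ((Finset.range (K ω)).filter fun i => X i ω ∈ B).card := by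
  rw [pointCount, ← Set.ncard_coe_finset]
  congr 1
  ext i
  simp

/-! ### Generating functional and void probabilities of a marked Poisson process -/

section PointProcess

variable {Ω E : Type*} [MeasurableSpace Ω] [MeasurableSpace E]

/-- Probability generating function of the Poisson distribution. -/
lemma integral_pow_poissonMeasure (a : NNReal) (c : ℝ) :
    ∫ n, c ^ n ∂(poissonMeasure a) = Real.exp (a * (c - 1)) := by
  rw [integral_poissonMeasure]
  have h := (NormedSpace.expSeries_div_hasSum_exp ((a : ℝ) * c)).mul_left (Real.exp (-a))
  rw [← Real.exp_eq_exp_ℝ, ← Real.exp_add] at h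
  rw [show (a : ℝ) * (c - 1) = -a + a * c by ring, ← h.tsum_eq]
  refine tsum_congr fun n => ?_
  rw [smul_eq_mul, mul_pow]
  ring

/-- The number of factors is random, but it ranges over a countable set, so measurability for each
fixed number suffices. -/
lemma measurable_prod_range {K : Ω → ℕ} (hK : Measurable K) {f : ℕ → Ω → ℝ}
    (hf : ∀ i, Measurable (f i)) : Measurable fun ω => ∏ i ∈ Finset.range (K ω), f i ω := by
  have h : Measurable fun q : ℕ × Ω => ∏ i ∈ Finset.range q.1, f i q.2 :=
    measurable_from_prod_countable_right fun n =>
      Finset.measurable_fun_prod (Finset.range n) fun i _ => hf i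
  exact h.comp (hK.prodMk measurable_id)

/-- The probability generating functional of a Poisson process at a simple function. -/
lemma IsPoissonPointProcess.integral_prod_simpleFunc {K : Ω → ℕ} {X : ℕ → Ω → E} {Λ : Measure E}
    [IsFiniteMeasure Λ] {P : Measure Ω} (hX : IsPoissonPointProcess K X Λ P)
    (g : SimpleFunc E ℝ) :
    ∫ ω, ∏ i ∈ Finset.range (K ω), g (X i ω) ∂P = Real.exp (∫ x, (g x - 1) ∂Λ) := by
  classical
  -- Grouping the points by the value of `g` leaves powers of counts in the disjoint fibres, which
  -- are independent Poisson variables.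
  have hprod : ∀ ω, ∏ i ∈ Finset.range (K ω), g (X i ω)
      = ∏ c : g.range, (c : ℝ) ^ pointCount K X (g ⁻¹' {(c : ℝ)}) ω := by
    intro ω
    rw [Finset.prod_coe_sort g.range fun c => c ^ pointCount K X (g ⁻¹' {c}) ω,
      ← Finset.prod_fiberwise_of_maps_to (t := g.range) (g := fun i => g (X i ω))
        (fun i _ => g.mem_range_self _)]
    refine Finset.prod_congr rfl fun c _ => ?_
    rw [pointCount_eq_card, Finset.prod_congr rfl (g := fun _ => c)
      (fun i hi => (Finset.mem_filter.1 hi).2), Finset.prod_const]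
    rfl
  have hind : iIndepFun (fun c : g.range => pointCount K X (g ⁻¹' {(c : ℝ)})) P := by
    have e := Fintype.equivFin g.range
    have h := (hX.count_indep _ (fun j => g ⁻¹' {((e.symm j : g.range) : ℝ)})
      (fun j => g.measurableSet_preimage _) (fun j k hjk => by
        refine Disjoint.preimage _ (Set.disjoint_singleton.2 fun h => hjk ?_)
        exact e.symm.injective (Subtype.ext h))).precomp e.injective
    simpa using h
  simp_rw [hprod]
  rw [hind.integral_fun_prod_comp (f := fun (c : g.range) (n : ℕ) => (c : ℝ) ^ n)
    (fun c => (hX.count_law _ (g.measurableSet_preimage _)).aemeasurable)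
    (fun c => (measurable_of_countable _).aestronglyMeasurable)]
  have hone : ∀ c : g.range, ∫ ω, (c : ℝ) ^ pointCount K X (g ⁻¹' {(c : ℝ)}) ω ∂P
      = Real.exp (Λ.real (g ⁻¹' {(c : ℝ)}) * (c - 1)) := fun c => by
    have h := (hX.count_law _ (g.measurableSet_preimage {(c : ℝ)})).integral_comp
      (f := fun n => (c : ℝ) ^ n) (measurable_of_countable _).aestronglyMeasurable
    rw [integral_pow_poissonMeasure] at h
    exact h
  simp_rw [hone]
  have hgi : Integrable g Λ := SimpleFunc.integrable_of_isFiniteMeasure g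
  rw [← Real.exp_sum, integral_sub hgi (integrable_const 1)]
  have hone' : ∫ _ : E, (1 : ℝ) ∂Λ = ∑ c ∈ g.range, Λ.real (g ⁻¹' {c}) := by
    rw [integral_const, smul_eq_mul, mul_one]
    have h := g.sum_range_measure_preimage_singleton Λ
    rw [measureReal_def, ← h, ENNReal.toReal_sum fun _ _ => measure_ne_top _ _]
    rfl
  rw [hone', SimpleFunc.integral_eq_sum g hgi,
    Finset.sum_coe_sort g.range fun c => Λ.real (g ⁻¹' {c}) * (c - 1), ← Finset.sum_sub_distrib]
  simp [mul_sub]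

/-- The probability generating functional of a Poisson process. -/
theorem IsPoissonPointProcess.integral_prod {K : Ω → ℕ} {X : ℕ → Ω → E} {Λ : Measure E}
    [IsFiniteMeasure Λ] {P : Measure Ω} [IsProbabilityMeasure P]
    (hX : IsPoissonPointProcess K X Λ P) {g : E → ℝ} (hg : Measurable g) (hg1 : ∀ x, ‖g x‖ ≤ 1) :
    ∫ ω, ∏ i ∈ Finset.range (K ω), g (X i ω) ∂P = Real.exp (∫ x, (g x - 1) ∂Λ) := by
  have hs := hg.stronglyMeasurable
  -- Approximants bounded by 1 keep every product bounded by 1, whatever the number of factors, so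
  -- dominated convergence applies.
  have hle := hs.norm_approxBounded_le zero_le_one
  have htend := fun x => hs.tendsto_approxBounded_of_norm_le (hg1 x)
  have h1 : Filter.Tendsto
      (fun n => ∫ ω, ∏ i ∈ Finset.range (K ω), hs.approxBounded 1 n (X i ω) ∂P) Filter.atTop
      (nhds (∫ ω, ∏ i ∈ Finset.range (K ω), g (X i ω) ∂P)) := by
    refine tendsto_integral_of_dominated_convergence (fun _ => 1) (fun n => ?_)
      (integrable_const 1) (fun n => ?_) ?_
    · exact (measurable_prod_range hX.measurable_num fun i =>
        (hs.approxBounded 1 n).measurable.comp (hX.measurable_point i)).aestronglyMeasurable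
    · filter_upwards with ω
      rw [norm_prod]
      exact Finset.prod_le_one (fun _ _ => norm_nonneg _) fun _ _ => hle _ _
    · filter_upwards with ω
      exact tendsto_finsetProd _ fun i _ => htend _
  have h2 : Filter.Tendsto (fun n => ∫ x, (hs.approxBounded 1 n x - 1) ∂Λ) Filter.atTop
      (nhds (∫ x, (g x - 1) ∂Λ)) := by
    refine tendsto_integral_of_dominated_convergence (fun _ => 2) (fun n => ?_)
      (integrable_const 2) (fun n => ?_) ?_
    · exact ((hs.approxBounded 1 n).measurable.sub_const 1).aestronglyMeasurable
    · filter_upwards with x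
      refine (norm_sub_le _ _).trans ?_
      rw [norm_one]
      linarith [hle n x]
    · filter_upwards with x
      exact (htend x).sub_const 1
  simp_rw [hX.integral_prod_simpleFunc] at h1
  exact tendsto_nhds_unique h1 ((Real.continuous_exp.tendsto _).comp h2)

lemma configSigma_le {K : Ω → ℕ} {X : ℕ → Ω → E} (hK : Measurable K)
    (hX : ∀ i, Measurable (X i)) : configSigma K X ≤ ‹MeasurableSpace Ω› :=
  (hK.prodMk (measurable_pi_lambda _ hX)).comap_le

/-- The event that no marked point lies in `B`. -/
def noMarkedIn (K : Ω → ℕ) (X : ℕ → Ω → E) (Z : ℕ → Set Ω) (B : Set E) : Set Ω :=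
  {ω | ∀ i, i < K ω → ω ∈ Z i → X i ω ∉ B}

lemma measurableSet_noMarkedIn {K : Ω → ℕ} {X : ℕ → Ω → E} {Z : ℕ → Set Ω} {B : Set E}
    (hK : Measurable K) (hX : ∀ i, Measurable (X i)) (hZ : ∀ i, MeasurableSet (Z i))
    (hB : MeasurableSet B) : MeasurableSet (noMarkedIn K X Z B) := by
  have : noMarkedIn K X Z B = ⋂ i, ({ω | i < K ω}ᶜ ∪ ((Z i)ᶜ ∪ (X i ⁻¹' B)ᶜ)) := by
    ext ω
    simp only [noMarkedIn, Set.mem_ofPred_eq, Set.mem_iInter, Set.mem_union, Set.mem_compl_iff,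
      Set.mem_preimage]
    exact forall_congr' fun i => by tauto
  rw [this]
  exact MeasurableSet.iInter fun i => ((measurableSet_lt measurable_const hK).compl).union
    ((hZ i).compl.union (hX i hB).compl)

/-- Integrating the marks out of the probability that no marked point lies in `B`. -/
lemma IsIndependentMarking.measureReal_noMarkedIn {K : Ω → ℕ} {X : ℕ → Ω → E} {Z : ℕ → Set Ω}
    {p : E → ℝ} {P : Measure Ω} [IsProbabilityMeasure P] (hZ : IsIndependentMarking K X Z p P)
    (hK : Measurable K) (hX : ∀ i, Measurable (X i)) (hp : Measurable p)
    (hp01 : ∀ x, p x ∈ Set.Icc (0 : ℝ) 1) {B : Set E} (hB : MeasurableSet B) :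
    P.real (noMarkedIn K X Z B) =
      ∫ ω, ∏ i ∈ Finset.range (K ω), (1 - B.indicator p (X i ω)) ∂P := by
  classical
  have hm := configSigma_le hK hX
  have hA := measurableSet_noMarkedIn hK hX hZ.measurableSet_mark hB
  have hKn : ∀ n, MeasurableSet {ω | K ω = n} := fun n => hK (measurableSet_singleton n)
  have hdisj : Pairwise (Function.onFun Disjoint fun n => {ω | K ω = n}) := fun a b hab =>
    Set.disjoint_left.2 fun ω ha hb => hab (ha.symm.trans hb)
  have hcover : ⋃ n, {ω | K ω = n} = Set.univ := by ext; simp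
  have hb01 : ∀ x, B.indicator p x ∈ Set.Icc (0 : ℝ) 1 := fun x => by
    by_cases h : x ∈ B <;> simp [h, hp01 x]
  have hfi : Integrable (fun ω => ∏ i ∈ Finset.range (K ω), (1 - B.indicator p (X i ω))) P := by
    refine Integrable.of_bound (measurable_prod_range hK fun i =>
      ((hp.indicator hB).comp (hX i)).const_sub 1).aestronglyMeasurable 1 ?_
    filter_upwards with ω
    rw [norm_prod]
    refine Finset.prod_le_one (fun _ _ => norm_nonneg _) fun i _ => ?_
    rw [Real.norm_eq_abs, abs_le]
    constructor <;> linarith [(hb01 (X i ω)).1, (hb01 (X i ω)).2]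
  have hAi : Integrable ((noMarkedIn K X Z B).indicator fun _ => (1 : ℝ)) P :=
    (integrable_const 1).indicator hA
  rw [← integral_indicator_one hA]
  change ∫ ω, (noMarkedIn K X Z B).indicator (fun _ => (1 : ℝ)) ω ∂P = _
  -- Splitting by the value of `K` fixes the number of factors, so that the products can be expanded
  -- over subsets of indices.
  rw [← setIntegral_univ, ← hcover, integral_iUnion hKn hdisj hAi.integrableOn,
    ← setIntegral_univ, ← hcover, integral_iUnion hKn hdisj hfi.integrableOn]
  refine tsum_congr fun n => ?_
  -- the event that there are `n` points, those with index in `S` lie in `B`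
  let D : Finset ℕ → Set Ω := fun S => {ω | K ω = n ∧ ∀ i ∈ S, X i ω ∈ B}
  let M : Finset ℕ → Set Ω := fun S => ⋂ i ∈ S, ({ω | i < K ω} ∩ Z i)
  have hM : ∀ S, MeasurableSet (M S) := fun S => Finset.measurableSet_biInter _ fun i _ =>
    (measurableSet_lt measurable_const hK).inter (hZ.measurableSet_mark i)
  -- `D S` depends on the configuration alone, so the conditional expectation of the marks may be
  -- integrated over it.
  have hD' : ∀ S, MeasurableSet[configSigma K X] (D S) := fun S => by
    refine ⟨{q | q.1 = n ∧ ∀ i ∈ S, q.2 i ∈ B}, ?_, rfl⟩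
    have : {q : ℕ × (ℕ → E) | q.1 = n ∧ ∀ i ∈ S, q.2 i ∈ B}
        = Prod.fst ⁻¹' {n} ∩ ⋂ i ∈ S, (fun q : ℕ × (ℕ → E) => q.2 i) ⁻¹' B := by
      ext; simp
    rw [this]
    exact (measurable_fst (measurableSet_singleton n)).inter
      (Finset.measurableSet_biInter _ fun i _ => ((measurable_pi_apply i).comp measurable_snd) hB)
  have hD : ∀ S, MeasurableSet (D S) := fun S => hm _ (hD' S)
  have hDM : ∀ S, ∫ ω in D S, (M S).indicator (fun _ => (1 : ℝ)) ω ∂P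
      = ∫ ω in D S, ∏ i ∈ S, (if i < K ω then p (X i ω) else 0) ∂P := fun S => by
    rw [← setIntegral_condExp hm ((integrable_const 1).indicator (hM S)) (hD' S)]
    exact setIntegral_congr_ae (hD S) ((hZ.condExp_marks S).mono fun ω h _ => h)
  -- Integrability comes for free: the product agrees almost everywhere with a conditional
  -- expectation.
  have hpi : ∀ S : Finset ℕ,
      Integrable (fun ω => ∏ i ∈ S, (if i < K ω then p (X i ω) else 0)) P := fun S =>
    Integrable.congr integrable_condExp (hZ.condExp_marks S)
  -- Inclusion-exclusion. `hR` expands the other integrand over the same subsets, and `hDM` matches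
  -- the two sums term by term.
  have hL : ∀ ω ∈ {ω | K ω = n}, (noMarkedIn K X Z B).indicator (fun _ => (1 : ℝ)) ω
      = ∑ S ∈ (Finset.range n).powerset,
        (-1) ^ S.card * (D S).indicator ((M S).indicator fun _ => (1 : ℝ)) ω := by
    intro ω hω
    have hω' : K ω = n := hω
    have h1 : (noMarkedIn K X Z B).indicator (fun _ => (1 : ℝ)) ω
        = ∏ i ∈ Finset.range n, (1 + if ω ∈ Z i ∧ X i ω ∈ B then (-1 : ℝ) else 0) := by
      by_cases h : ω ∈ noMarkedIn K X Z B
      · rw [Set.indicator_of_mem h, Finset.prod_eq_one]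
        intro i hi
        rw [if_neg, add_zero]
        exact fun hc => h i (hω' ▸ Finset.mem_range.1 hi) hc.1 hc.2
      · rw [Set.indicator_of_notMem h]
        simp only [noMarkedIn, Set.mem_ofPred_eq, not_forall, not_not] at h
        obtain ⟨i, hi, hz, hx⟩ := h
        refine (Finset.prod_eq_zero (Finset.mem_range.2 (hω' ▸ hi)) ?_).symm
        rw [if_pos ⟨hz, hx⟩, add_neg_cancel]
    rw [h1, Finset.prod_one_add]
    refine Finset.sum_congr rfl fun S hS => ?_
    have hlt : ∀ i ∈ S, i < K ω := fun i hi =>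
      hω' ▸ Finset.mem_range.1 (Finset.mem_powerset.1 hS hi)
    by_cases h : ∀ i ∈ S, ω ∈ Z i ∧ X i ω ∈ B
    · have hd : ω ∈ D S := ⟨hω', fun i hi => (h i hi).2⟩
      have hmm : ω ∈ M S := Set.mem_iInter₂.2 fun i hi => ⟨hlt i hi, (h i hi).1⟩
      rw [Set.indicator_of_mem hd, Set.indicator_of_mem hmm, mul_one,
        Finset.prod_congr rfl fun i hi => if_pos (h i hi), Finset.prod_const]
    · have h0 : (D S).indicator ((M S).indicator fun _ => (1 : ℝ)) ω = 0 := by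
        by_contra hne
        have hd : ω ∈ D S := Set.mem_of_indicator_ne_zero hne
        rw [Set.indicator_of_mem hd] at hne
        have hmm : ω ∈ M S := Set.mem_of_indicator_ne_zero hne
        exact h fun i hi => ⟨(Set.mem_iInter₂.1 hmm i hi).2, hd.2 i hi⟩
      rw [h0, mul_zero]
      push Not at h
      obtain ⟨i, hi, hne⟩ := h
      exact Finset.prod_eq_zero hi (if_neg fun hc => hne hc.1 hc.2)
  have hR : ∀ ω ∈ {ω | K ω = n}, ∏ i ∈ Finset.range (K ω), (1 - B.indicator p (X i ω))
      = ∑ S ∈ (Finset.range n).powerset, (-1) ^ S.card *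
        (D S).indicator (fun ω => ∏ i ∈ S, (if i < K ω then p (X i ω) else 0)) ω := by
    intro ω hω
    have hω' : K ω = n := hω
    simp_rw [hω', sub_eq_add_neg]
    rw [Finset.prod_one_add]
    refine Finset.sum_congr rfl fun S hS => ?_
    have hlt : ∀ i ∈ S, i < n := fun i hi => Finset.mem_range.1 (Finset.mem_powerset.1 hS hi)
    rw [Finset.prod_neg]
    congr 1
    by_cases h : ∀ i ∈ S, X i ω ∈ B
    · rw [Set.indicator_of_mem (show ω ∈ D S from ⟨hω', h⟩)]
      refine Finset.prod_congr rfl fun i hi => ?_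
      rw [Set.indicator_of_mem (h i hi), hω', if_pos (hlt i hi)]
    · rw [Set.indicator_of_notMem (show ω ∉ D S from fun hd => h hd.2)]
      push Not at h
      obtain ⟨i, hi, hne⟩ := h
      exact Finset.prod_eq_zero hi (Set.indicator_of_notMem hne _)
  have hDsub : ∀ S, D S ∩ {ω | K ω = n} = D S := fun S =>
    Set.inter_eq_left.2 fun ω h => h.1
  rw [setIntegral_congr_fun (hKn n) hL, setIntegral_congr_fun (hKn n) hR,
    integral_finsetSum, integral_finsetSum]
  · refine Finset.sum_congr rfl fun S _ => ?_
    rw [integral_const_mul, integral_const_mul, integral_indicator (hD S),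
      integral_indicator (hD S), Measure.restrict_restrict (hD S), hDsub, hDM]
  · exact fun S _ => (((hpi S).indicator (hD S)).const_mul _).integrableOn
  · exact fun S _ =>
      ((((integrable_const 1).indicator (hM S)).indicator (hD S)).const_mul _).integrableOn

/-- Void probabilities of an independently thinned Poisson process. -/
theorem IsPoissonPointProcess.measureReal_noMarkedIn {K : Ω → ℕ} {X : ℕ → Ω → E}
    {Z : ℕ → Set Ω} {p : E → ℝ} {Λ : Measure E} [IsFiniteMeasure Λ] {P : Measure Ω}
    [IsProbabilityMeasure P] (hX : IsPoissonPointProcess K X Λ P)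
    (hZ : IsIndependentMarking K X Z p P) (hp : Measurable p)
    (hp01 : ∀ x, p x ∈ Set.Icc (0 : ℝ) 1) {B : Set E} (hB : MeasurableSet B) :
    P.real (noMarkedIn K X Z B) = Real.exp (-∫ x in B, p x ∂Λ) := by
  rw [hZ.measureReal_noMarkedIn hX.measurable_num hX.measurable_point hp hp01 hB,
    hX.integral_prod (g := fun x => 1 - B.indicator p x) ((hp.indicator hB).const_sub 1),
    ← integral_indicator hB, ← integral_neg]
  · simp
  · intro x
    rw [Real.norm_eq_abs, abs_le]
    by_cases h : x ∈ B
    · rw [Set.indicator_of_mem h]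
      constructor <;> linarith [(hp01 x).1, (hp01 x).2]
    · rw [Set.indicator_of_notMem h]
      norm_num

end PointProcess

/-! ### The arc of a circle around the user inside the disc -/

section Geometry

/-- The integral of a periodic indicator over a period does not depend on the starting point. This
allows measuring angles from the direction of the user. -/
lemma volume_toReal_periodic_shift {S : Set ℝ} (hS : MeasurableSet S)
    (hper : ∀ x, x + 2 * Real.pi ∈ S ↔ x ∈ S) (a b : ℝ) :
    (volume (Set.Ioc a (a + 2 * Real.pi) ∩ S)).toReal
      = (volume (Set.Ioc b (b + 2 * Real.pi) ∩ S)).toReal := by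
  have hP : Function.Periodic (S.indicator fun _ => (1 : ℝ)) (2 * Real.pi) := fun x => by
    by_cases h : x ∈ S
    · rw [Set.indicator_of_mem h, Set.indicator_of_mem ((hper x).2 h)]
    · rw [Set.indicator_of_notMem h, Set.indicator_of_notMem fun h' => h ((hper x).1 h')]
  have key : ∀ c, ∫ x in c..c + 2 * Real.pi, S.indicator (fun _ => (1 : ℝ)) x
      = (volume (Set.Ioc c (c + 2 * Real.pi) ∩ S)).toReal := fun c => by
    rw [intervalIntegral.integral_of_le (by linarith [Real.pi_pos]), setIntegral_indicator hS]
    simp [measureReal_def]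
  rw [← key, ← key, hP.intervalIntegral_add_eq a b]

lemma volume_cos_le {k : ℝ} (hk : k ∈ Set.Icc (-1 : ℝ) 1) :
    (volume (Set.Ioc (-Real.pi) Real.pi ∩ {x | Real.cos x ≤ k})).toReal
      = 2 * Real.pi - 2 * Real.arccos k := by
  have hcos := Real.cos_arccos hk.1 hk.2
  have h0 := Real.arccos_nonneg k
  have hpi := Real.arccos_le_pi k
  have : Set.Ioc (-Real.pi) Real.pi ∩ {x | Real.cos x ≤ k}
      = Set.Ioc (-Real.pi) Real.pi \ Set.Ioo (-Real.arccos k) (Real.arccos k) := by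
    ext x
    simp only [Set.mem_inter_iff, Set.mem_ofPred_eq, Set.mem_sdiff, Set.mem_Ioo, ← abs_lt, not_lt]
    refine and_congr_right fun hx => ?_
    -- Cosine is even and strictly decreasing on `[0, π]`, so the condition becomes `arccos k ≤
    -- |x|`.
    have hxa : |x| ∈ Set.Icc 0 Real.pi := ⟨abs_nonneg x, abs_le.2 ⟨hx.1.le, hx.2⟩⟩
    rw [← Real.cos_abs]
    nth_rewrite 1 [← hcos]
    exact Real.strictAntiOn_cos.le_iff_ge hxa ⟨h0, hpi⟩
  have hsub : Set.Ioo (-Real.arccos k) (Real.arccos k) ⊆ Set.Ioc (-Real.pi) Real.pi :=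
    fun x hx => ⟨by linarith [hx.1], by linarith [hx.2]⟩
  rw [this, measure_sdiff hsub measurableSet_Ioo.nullMeasurableSet (by simp), Real.volume_Ioc,
    Real.volume_Ioo, ← ENNReal.ofReal_sub _ (by linarith), ENNReal.toReal_ofReal (by linarith)]
  ring

lemma norm_add_smul_sq (u : Plane) (l φ : ℝ) :
    ‖u + l • (!₂[Real.cos φ, Real.sin φ] : Plane)‖ ^ 2
      = ‖u‖ ^ 2 + l ^ 2 + 2 * l * (u 0 * Real.cos φ + u 1 * Real.sin φ) := by
  rw [EuclideanSpace.real_norm_sq_eq, EuclideanSpace.real_norm_sq_eq, Fin.sum_univ_two,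
    Fin.sum_univ_two]
  simp
  linear_combination l ^ 2 * Real.sin_sq_add_cos_sq φ

lemma exists_polar (u : Plane) : ∃ ψ : ℝ, u 0 = ‖u‖ * Real.cos ψ ∧ u 1 = ‖u‖ * Real.sin ψ := by
  have h : ‖(⟨u 0, u 1⟩ : ℂ)‖ = ‖u‖ := by
    rw [EuclideanSpace.norm_eq, Fin.sum_univ_two, Complex.norm_eq_sqrt_sq_add_sq]
    simp
  refine ⟨Complex.arg ⟨u 0, u 1⟩, ?_, ?_⟩
  · rw [← h, Complex.norm_mul_cos_arg]
  · rw [← h, Complex.norm_mul_sin_arg]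

/-- Directions `φ` in which the point at distance `l` from `u` lies in the disc of radius `R`. -/
def directionsInDisc (R l : ℝ) (u : Plane) : Set ℝ :=
  {φ | u + l • (!₂[Real.cos φ, Real.sin φ] : Plane) ∈ Metric.closedBall (0 : Plane) R}

lemma mem_directionsInDisc {R l : ℝ} {u : Plane} (hR : 0 ≤ R) {φ : ℝ} :
    φ ∈ directionsInDisc R l u ↔
      ‖u‖ ^ 2 + l ^ 2 + 2 * l * (u 0 * Real.cos φ + u 1 * Real.sin φ) ≤ R ^ 2 := by
  rw [← norm_add_smul_sq, sq_le_sq₀ (norm_nonneg _) hR]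
  simp [directionsInDisc]

lemma circleLengthInDisc_eq (R l : ℝ) (u : Plane) : circleLengthInDisc R l u
    = l * (volume (Set.Ioc (-Real.pi) Real.pi ∩ directionsInDisc R l u)).toReal := rfl

/-- Membership in `directionsInDisc` in terms of the angle with the direction of `u`. -/
lemma directionsInDisc_eq {R l : ℝ} {u : Plane} (hR : 0 ≤ R) {ψ : ℝ}
    (h0 : u 0 = ‖u‖ * Real.cos ψ) (h1 : u 1 = ‖u‖ * Real.sin ψ) :
    directionsInDisc R l u
      = {φ | ‖u‖ ^ 2 + l ^ 2 + 2 * l * ‖u‖ * Real.cos (φ - ψ) ≤ R ^ 2} := by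
  ext φ
  rw [mem_directionsInDisc hR, Set.mem_ofPred_eq, Real.cos_sub, h0, h1]
  ring_nf

lemma circleLengthInDisc_of_le {R l : ℝ} {u : Plane} (hl0 : 0 ≤ l) (hl : l ≤ R - ‖u‖) :
    circleLengthInDisc R l u = 2 * Real.pi * l := by
  have hR : 0 ≤ R := by linarith [norm_nonneg u]
  obtain ⟨ψ, h0, h1⟩ := exists_polar u
  have : directionsInDisc R l u = Set.univ := by
    rw [directionsInDisc_eq hR h0 h1]
    refine Set.eq_univ_of_forall fun φ => ?_
    rw [Set.mem_ofPred_eq]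
    have := mul_le_mul_of_nonneg_left (Real.cos_le_one (φ - ψ))
      (by positivity : 0 ≤ 2 * l * ‖u‖)
    nlinarith [norm_nonneg u]
  rw [circleLengthInDisc_eq, this, Set.inter_univ, Real.volume_Ioc,
    ENNReal.toReal_ofReal (by linarith [Real.pi_pos])]
  ring

lemma circleLengthInDisc_of_gt {R l : ℝ} {u : Plane} (hR : 0 ≤ R) (hl : R + ‖u‖ < l) :
    circleLengthInDisc R l u = 0 := by
  obtain ⟨ψ, h0, h1⟩ := exists_polar u
  have hu := norm_nonneg u
  have : directionsInDisc R l u = ∅ := by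
    rw [directionsInDisc_eq hR h0 h1]
    refine Set.eq_empty_of_forall_notMem fun φ => ?_
    rw [Set.mem_ofPred_eq, not_le]
    have := mul_le_mul_of_nonneg_left (Real.neg_one_le_cos (φ - ψ))
      (by have : 0 ≤ l := by linarith
          positivity : 0 ≤ 2 * l * ‖u‖)
    nlinarith
  rw [circleLengthInDisc_eq, this]
  simp

/-- The cosine of the angle, at the user, between the direction away from the centre and the
points where the two circles meet. -/
noncomputable def interCos (R l r : ℝ) : ℝ := (R ^ 2 - r ^ 2 - l ^ 2) / (2 * r * l)

lemma interCos_mem {R l r : ℝ} (hr : 0 < r) (hrR : r ≤ R) (hl1 : R - r < l) (hl2 : l < R + r) :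
    interCos R l r ∈ Set.Ioo (-1 : ℝ) 1 := by
  have hl : 0 < l := by linarith
  have hd : 0 < 2 * r * l := by positivity
  rw [interCos, Set.mem_Ioo, lt_div_iff₀ hd, div_lt_one hd]
  constructor <;> nlinarith

/-- Heron's product is `(2rl)²` times the squared sine of the angle at the user: twice the area of
the triangle is `r l sin`. -/
lemma x₁_eq {R l r : ℝ} (hr : 0 < r) (hl : 0 < l) :
    x₁ R l r = l * Real.sqrt (1 - interCos R l r ^ 2) := by
  have h : (r + R + l) * (r + R - l) * (r - R + l) * (-r + R + l)
      = (2 * r * l) ^ 2 * (1 - interCos R l r ^ 2) := by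
    rw [interCos]
    field_simp
    ring
  rw [x₁, heronArea, h, Real.sqrt_mul (sq_nonneg _), Real.sqrt_sq (by positivity)]
  field_simp
  ring

lemma yInter_sub {R l r : ℝ} (hr : 0 < r) (hl : 0 < l) :
    yInter R l r - r = l * interCos R l r := by
  rw [yInter, interCos]
  field_simp
  ring

lemma m₁_eq {R l r : ℝ} (hr : 0 < r) (hl : 0 < l) :
    m₁ R l r = interCos R l r / Real.sqrt (1 - interCos R l r ^ 2) := by
  rw [m₁, x₁_eq hr hl, yInter_sub hr hl, mul_div_mul_left _ _ hl.ne']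

lemma m₂_eq_neg (R l r : ℝ) : m₂ R l r = -m₁ R l r := by
  rw [m₂, m₁, x₂, x₁, div_neg]

/-- With `k = interCos R l r`, the slope `m₁ = k / √(1 - k²)` is the tangent of `arcsin k = π/2 -
arccos k`, and `m₂ = -m₁`. -/
lemma arcAngle_eq {R l r : ℝ} (hr : 0 < r) (hrR : r ≤ R) (hl1 : R - r < l) (hl2 : l < R + r) :
    arcAngle R l r = 2 * Real.pi - 2 * Real.arccos (interCos R l r) := by
  rw [arcAngle, if_pos hl2, m₂_eq_neg, Real.arctan_neg, m₁_eq hr (by linarith),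
    ← Real.arcsin_eq_arctan (interCos_mem hr hrR hl1 hl2), Real.arccos]
  ring

/-- The angle is `2 arctan m₁ + π`; `π` is a period of the tangent, and the rest is the double angle
formula. -/
lemma tan_arcAngle {R l r : ℝ} (hl2 : l < R + r) :
    Real.tan (arcAngle R l r) = (m₁ R l r - m₂ R l r) / (1 + m₁ R l r * m₂ R l r) := by
  rw [arcAngle, if_pos hl2, m₂_eq_neg, Real.arctan_neg,
    show Real.pi + Real.arctan (m₁ R l r) - -Real.arctan (m₁ R l r)
      = 2 * Real.arctan (m₁ R l r) + Real.pi by ring, Real.tan_add_pi, Real.tan_two_mul,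
    Real.tan_arctan]
  ring

/-- The circle of radius `l` around `u` meets the disc in an arc. -/
lemma circleLengthInDisc_of_mem {R l : ℝ} {u : Plane} (hu : ‖u‖ ≤ R) (hl : R - ‖u‖ < l)
    (hl2 : l ≤ R + ‖u‖) :
    circleLengthInDisc R l u = (2 * Real.pi - 2 * Real.arccos (interCos R l ‖u‖)) * l := by
  have hl0 : 0 < l := by linarith
  have hR : 0 ≤ R := (norm_nonneg u).trans hu
  obtain ⟨ψ, h0, h1⟩ := exists_polar u
  -- The bounds on `l` exclude a user at the centre.
  have hr : 0 < ‖u‖ := by linarith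
  have hk : interCos R l ‖u‖ ∈ Set.Icc (-1 : ℝ) 1 := by
    have hd : 0 < 2 * ‖u‖ * l := by positivity
    rw [interCos, Set.mem_Icc, le_div_iff₀ hd, div_le_one hd]
    constructor <;> nlinarith
  have hset : directionsInDisc R l u = {φ | Real.cos (φ - ψ) ≤ interCos R l ‖u‖} := by
    rw [directionsInDisc_eq hR h0 h1]
    ext φ
    rw [Set.mem_ofPred_eq, Set.mem_ofPred_eq, interCos, le_div_iff₀ (by positivity)]
    constructor <;> intro h <;> linarith
  have hmeas : MeasurableSet {x | Real.cos (x - ψ) ≤ interCos R l ‖u‖} :=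
    measurableSet_le (by fun_prop) measurable_const
  have hshift := volume_toReal_periodic_shift hmeas (fun x => by
    rw [Set.mem_ofPred_eq, Set.mem_ofPred_eq, add_sub_right_comm, Real.cos_add_two_pi])
    (-Real.pi) (ψ - Real.pi)
  have htrans : volume (Set.Ioc (ψ - Real.pi) (ψ - Real.pi + 2 * Real.pi) ∩
      {x | Real.cos (x - ψ) ≤ interCos R l ‖u‖})
      = volume (Set.Ioc (-Real.pi) Real.pi ∩ {x | Real.cos x ≤ interCos R l ‖u‖}) := by
    rw [← measure_preimage_add_right volume ψ]
    congr 1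
    ext x
    simp only [Set.mem_preimage, Set.mem_inter_iff, Set.mem_Ioc, Set.mem_ofPred_eq,
      add_sub_cancel_right]
    refine and_congr_left fun _ => ?_
    constructor <;> rintro ⟨a, b⟩ <;> constructor <;> linarith
  rw [htrans, show -Real.pi + 2 * Real.pi = Real.pi by ring, volume_cos_le hk] at hshift
  rw [circleLengthInDisc_eq, hset, hshift]
  ring

lemma arcC_eq_circleLengthInDisc {R l : ℝ} {u : Plane} (hu : ‖u‖ ≤ R) (hl : R - ‖u‖ < l) :
    arcC R l ‖u‖ = circleLengthInDisc R l u := by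
  have hR : 0 ≤ R := (norm_nonneg u).trans hu
  rcases lt_trichotomy l (R + ‖u‖) with hlt | heq | hgt
  · rw [circleLengthInDisc_of_mem hu hl hlt.le, arcC,
      arcAngle_eq (by linarith) hu hl hlt]
  -- At external tangency `arcAngle` is 0 by its default branch; the true arc also has length 0,
  -- since `arccos (-1) = π`.
  · have hr : 0 < ‖u‖ := by linarith
    have hk : interCos R l ‖u‖ = -1 := by
      have hl0 : 0 < l := by linarith
      rw [interCos, div_eq_iff (by positivity), heq]
      ring
    rw [arcC, arcAngle, if_neg heq.not_lt, zero_mul, circleLengthInDisc_of_mem hu hl heq.le, hk,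
      Real.arccos_neg_one, sub_self, zero_mul]
  · rw [arcC, arcAngle, if_neg hgt.not_gt, zero_mul, circleLengthInDisc_of_gt hR hgt]

end Geometry

/-! ### Polar coordinates around the user, and hazard rates -/

section Polar

lemma measurableSet_directionsInDisc_graph {R : ℝ} (hR : 0 ≤ R) (u : Plane) :
    MeasurableSet {q : ℝ × ℝ | q.2 ∈ directionsInDisc R q.1 u} := by
  simp_rw [mem_directionsInDisc hR]
  exact measurableSet_le (by fun_prop) measurable_const

lemma measurableSet_directionsInDisc {R : ℝ} (hR : 0 ≤ R) (l : ℝ) (u : Plane) :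
    MeasurableSet (directionsInDisc R l u) :=
  measurable_prodMk_left (measurableSet_directionsInDisc_graph hR u)

lemma measurable_circleLengthInDisc {R : ℝ} (hR : 0 ≤ R) (u : Plane) :
    Measurable fun l => circleLengthInDisc R l u := by
  have h : Measurable fun l : ℝ =>
      volume (Prod.mk l ⁻¹' ((Prod.snd ⁻¹' Set.Ioc (-Real.pi) Real.pi) ∩
        {q : ℝ × ℝ | q.2 ∈ directionsInDisc R q.1 u})) :=
    measurable_measure_prodMk_left
      ((measurable_snd measurableSet_Ioc).inter (measurableSet_directionsInDisc_graph hR u))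
  exact measurable_id.mul h.ennreal_toReal

lemma circleLengthInDisc_mem_Icc {R l : ℝ} (hl : 0 ≤ l) (u : Plane) :
    circleLengthInDisc R l u ∈ Set.Icc 0 (2 * Real.pi * l) := by
  rw [circleLengthInDisc_eq]
  refine ⟨by positivity, ?_⟩
  rw [mul_comm]
  refine mul_le_mul_of_nonneg_right ?_ hl
  refine ENNReal.toReal_le_of_le_ofReal (by positivity)
    ((measure_mono Set.inter_subset_left).trans ?_)
  rw [Real.volume_Ioc]
  exact ENNReal.ofReal_le_ofReal (by linarith)

/-- Away from the two tangency radii a single formula holds near `l`. For a user at the centre these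
radii coincide, and if `R > 0` the length jumps there. A finite exceptional set is harmless for the
fundamental theorem of calculus. -/
lemma continuousAt_circleLengthInDisc {R l : ℝ} {u : Plane} (hu : ‖u‖ ≤ R) (hl : 0 < l)
    (h1 : l ≠ R - ‖u‖) (h2 : l ≠ R + ‖u‖) :
    ContinuousAt (fun v => circleLengthInDisc R v u) l := by
  have hR : 0 ≤ R := (norm_nonneg u).trans hu
  rcases lt_or_gt_of_ne h1 with h1 | h1
  · refine ContinuousAt.congr (f := fun v => 2 * Real.pi * v) (by fun_prop) ?_
    filter_upwards [Ioo_mem_nhds hl h1] with v hv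
    rw [circleLengthInDisc_of_le hv.1.le hv.2.le]
  rcases lt_or_gt_of_ne h2 with h2 | h2
  · have hr : ‖u‖ ≠ 0 := by linarith
    refine ContinuousAt.congr
      (f := fun v => (2 * Real.pi - 2 * Real.arccos (interCos R v ‖u‖)) * v) ?_ ?_
    · have : ContinuousAt (fun v => interCos R v ‖u‖) l := by
        unfold interCos
        exact ContinuousAt.div (by fun_prop) (by fun_prop)
          (mul_ne_zero (mul_ne_zero two_ne_zero hr) hl.ne')
      have := Real.continuous_arccos.continuousAt.comp this
      exact (continuousAt_const.sub (this.const_mul 2)).mul continuousAt_id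
    · filter_upwards [Ioo_mem_nhds h1 h2] with v hv
      rw [circleLengthInDisc_of_mem hu hv.1 hv.2.le]
  · refine ContinuousAt.congr (f := fun _ => 0) (by fun_prop) ?_
    filter_upwards [Ioi_mem_nhds h2] with v hv
    rw [circleLengthInDisc_of_gt hR hv]

lemma circleLengthInDisc_pos {R l : ℝ} {u : Plane} (hu : ‖u‖ ≤ R) (hl : 0 < l)
    (hl2 : l < R + ‖u‖) : 0 < circleLengthInDisc R l u := by
  rcases le_or_gt l (R - ‖u‖) with h | h
  · rw [circleLengthInDisc_of_le hl.le h]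
    positivity
  · have hk := (interCos_mem (by linarith) hu h hl2).1
    rw [circleLengthInDisc_of_mem hu h hl2.le]
    have := Real.arccos_lt_arccos le_rfl hk (interCos_mem (by linarith) hu h hl2).2.le
    rw [Real.arccos_neg_one] at this
    exact mul_pos (by linarith) hl

lemma lintegral_plane_eq_polar (F : Plane → ENNReal) :
    ∫⁻ x, F x = ∫⁻ q in polarCoord.target, ENNReal.ofReal q.1 *
      F (q.1 • (!₂[Real.cos q.2, Real.sin q.2] : Plane)) := by
  have h1 : ∫⁻ x, F x = ∫⁻ y : Fin 2 → ℝ, F (WithLp.toLp 2 y) :=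
    ((PiLp.volume_preserving_toLp (Fin 2)).lintegral_comp_emb
      (MeasurableEquiv.toLp 2 (Fin 2 → ℝ)).measurableEmbedding F).symm
  have h2 : ∫⁻ y : Fin 2 → ℝ, F (WithLp.toLp 2 y)
      = ∫⁻ q : ℝ × ℝ, F (!₂[q.1, q.2] : Plane) :=
    ((volume_preserving_finTwoArrow ℝ).symm.lintegral_comp_emb
      (MeasurableEquiv.finTwoArrow (α := ℝ)).symm.measurableEmbedding
      fun y => F (WithLp.toLp 2 y)).symm
  rw [h1, h2, ← lintegral_comp_polarCoord_symm]
  refine lintegral_congr fun q => ?_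
  rw [smul_eq_mul, polarCoord_symm_apply]
  congr 2
  ext i
  fin_cases i <;> simp

/-- Integration over the part of the disc within distance `t` of `u`, in polar coordinates
around `u`. -/
lemma lintegral_ball_inter_disc {R : ℝ} (hR : 0 ≤ R) (u : Plane) (t : ℝ) {q : ℝ → ENNReal}
    (hq : Measurable q) :
    ∫⁻ x in Metric.closedBall u t ∩ Metric.closedBall 0 R, q (dist x u)
      = ∫⁻ v in Set.Ioc 0 t, ENNReal.ofReal (circleLengthInDisc R v u) * q v := by
  have hB : MeasurableSet (Metric.closedBall u t ∩ Metric.closedBall (0 : Plane) R) :=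
    measurableSet_closedBall.inter measurableSet_closedBall
  rw [← lintegral_indicator hB, ← lintegral_add_left_eq_self _ u, lintegral_plane_eq_polar,
    polarCoord_target, Measure.volume_eq_prod, ← Measure.prod_restrict]
  -- After translating `u` to the origin, the integrand splits into a radial factor and the
  -- indicator of the admissible directions.
  have hG : ∀ v φ : ℝ, v ∈ Set.Ioi (0 : ℝ) →
      ENNReal.ofReal v * (Metric.closedBall u t ∩ Metric.closedBall (0 : Plane) R).indicator
        (fun x => q (dist x u)) (u + v • (!₂[Real.cos φ, Real.sin φ] : Plane))
      = ENNReal.ofReal v * (Set.Iic t).indicator q v *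
        (directionsInDisc R v u).indicator 1 φ := by
    intro v φ hv
    have hd : dist (u + v • (!₂[Real.cos φ, Real.sin φ] : Plane)) u = v := by
      rw [dist_eq_norm, add_sub_cancel_left, norm_smul, EuclideanSpace.norm_eq, Fin.sum_univ_two]
      simp [abs_of_pos (Set.mem_Ioi.1 hv)]
    by_cases h1 : v ≤ t
    · by_cases h2 : φ ∈ directionsInDisc R v u
      · have hmem : u + v • (!₂[Real.cos φ, Real.sin φ] : Plane) ∈
            Metric.closedBall u t ∩ Metric.closedBall (0 : Plane) R :=
          ⟨by rwa [Metric.mem_closedBall, hd], h2⟩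
        rw [Set.indicator_of_mem hmem,
          Set.indicator_of_mem (Set.mem_Iic.2 h1), Set.indicator_of_mem h2, hd]
        simp
      · rw [Set.indicator_of_notMem fun h => h2 h.2, Set.indicator_of_notMem h2]
        simp
    · rw [Set.indicator_of_notMem fun h => h1 (by simpa [Metric.mem_closedBall, hd] using h.1),
        Set.indicator_of_notMem (show v ∉ Set.Iic t from h1)]
      simp
  rw [lintegral_prod]
  · have hin : ∀ v ∈ Set.Ioi (0 : ℝ), ∫⁻ φ in Set.Ioo (-Real.pi) Real.pi,
        ENNReal.ofReal v * (Metric.closedBall u t ∩ Metric.closedBall (0 : Plane) R).indicator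
          (fun x => q (dist x u)) (u + v • (!₂[Real.cos φ, Real.sin φ] : Plane))
        = (Set.Iic t).indicator (fun v => ENNReal.ofReal (circleLengthInDisc R v u) * q v) v := by
      intro v hv
      have hm := measurableSet_directionsInDisc hR v u
      rw [lintegral_congr fun φ => hG v φ hv,
        lintegral_const_mul _ (measurable_one.indicator hm), lintegral_indicator_one hm,
        Measure.restrict_congr_set Ioo_ae_eq_Ioc, Measure.restrict_apply hm, Set.inter_comm]
      by_cases h1 : v ∈ Set.Iic t
      · rw [Set.indicator_of_mem h1, Set.indicator_of_mem h1, circleLengthInDisc_eq,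
          ENNReal.ofReal_mul (le_of_lt hv), ENNReal.ofReal_toReal]
        · ring
        · exact ((measure_mono Set.inter_subset_left).trans_lt (by simp)).ne
      · rw [Set.indicator_of_notMem h1, Set.indicator_of_notMem h1]
        simp
    rw [setLIntegral_congr_fun measurableSet_Ioi hin, setLIntegral_indicator measurableSet_Iic,
      Set.inter_comm, Set.Ioi_inter_Iic]
  · refine Measurable.aemeasurable ?_
    refine measurable_fst.ennreal_ofReal.mul ?_
    refine ((hq.comp (by fun_prop)).indicator hB).comp ?_
    refine (measurable_const_add u).comp (measurable_fst.smul ?_)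
    refine (MeasurableEquiv.toLp 2 (Fin 2 → ℝ)).measurable.comp (measurable_pi_lambda _ fun i => ?_)
    fin_cases i
    · exact Real.measurable_cos.comp measurable_snd
    · exact Real.measurable_sin.comp measurable_snd

lemma intervalIntegrable_circleLength_mul {R : ℝ} (hR : 0 ≤ R) (u : Plane) {p : ℝ → ℝ}
    (hp : Measurable p) (hp01 : ∀ v, p v ∈ Set.Icc (0 : ℝ) 1) {a b : ℝ} (ha : 0 ≤ a)
    (hb : 0 ≤ b) :
    IntervalIntegrable (fun v => circleLengthInDisc R v u * p v) volume a b := by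
  have key : ∀ {t : ℝ}, 0 ≤ t →
      IntervalIntegrable (fun v => circleLengthInDisc R v u * p v) volume 0 t := fun {t} ht => by
    rw [intervalIntegrable_iff_integrableOn_Ioc_of_le ht]
    refine Measure.integrableOn_of_bounded (M := 2 * Real.pi * t) (by simp)
      ((measurable_circleLengthInDisc hR u).mul hp).aestronglyMeasurable ?_
    refine (ae_restrict_iff' measurableSet_Ioc).2 (Filter.Eventually.of_forall fun v hv => ?_)
    have h1 := circleLengthInDisc_mem_Icc (R := R) hv.1.le u
    rw [norm_mul, Real.norm_of_nonneg h1.1, Real.norm_of_nonneg (hp01 v).1]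
    calc _ ≤ 2 * Real.pi * v * 1 :=
          mul_le_mul h1.2 (hp01 v).2 (hp01 v).1 (by have := hv.1.le; positivity)
      _ ≤ _ := by nlinarith [hv.2, Real.pi_pos]
  exact (key ha).symm.trans (key hb)

/-- Nonnegativity reduces this to `lintegral_ball_inter_disc`, where no integrability is needed. -/
lemma integral_ball_disc {R lb t : ℝ} (hR : 0 ≤ R) (hlb : 0 ≤ lb) (ht : 0 ≤ t) (u : Plane)
    {p : ℝ → ℝ} (hp : Measurable p) (hp01 : ∀ v, p v ∈ Set.Icc (0 : ℝ) 1) :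
    ∫ x in Metric.closedBall u t, p (dist x u)
        ∂(ENNReal.ofReal lb • volume.restrict (Metric.closedBall 0 R))
      = lb * ∫ v in (0 : ℝ)..t, circleLengthInDisc R v u * p v := by
  rw [Measure.restrict_smul, integral_smul_measure, ENNReal.toReal_ofReal hlb, smul_eq_mul,
    Measure.restrict_restrict measurableSet_closedBall, intervalIntegral.integral_of_le ht]
  congr 1
  rw [integral_eq_lintegral_of_nonneg_ae, integral_eq_lintegral_of_nonneg_ae,
    lintegral_ball_inter_disc hR u t hp.ennreal_ofReal]
  · congr 1
    refine setLIntegral_congr_fun measurableSet_Ioc fun v hv => ?_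
    exact (ENNReal.ofReal_mul (circleLengthInDisc_mem_Icc hv.1.le u).1).symm
  · refine (ae_restrict_iff' measurableSet_Ioc).2 (Filter.Eventually.of_forall fun v hv => ?_)
    exact mul_nonneg (circleLengthInDisc_mem_Icc hv.1.le u).1 (hp01 v).1
  · exact ((measurable_circleLengthInDisc hR u).mul hp).aestronglyMeasurable
  · exact Filter.Eventually.of_forall fun x => (hp01 _).1
  · exact (hp.comp (by fun_prop)).aestronglyMeasurable

/-- The law with hazard rate `h` has distribution function `1 - exp (-∫ h)`. -/
lemma integral_mul_exp_neg_primitive {h : ℝ → ℝ} {s : Set ℝ} (hs : s.Countable)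
    (hm : Measurable h) {t : ℝ} (hi : IntervalIntegrable h volume 0 t) (ht : 0 ≤ t)
    (hc : ∀ v, 0 < v → v ∉ s → ContinuousAt h v) :
    IntervalIntegrable (fun v => h v * Real.exp (-∫ w in (0 : ℝ)..v, h w)) volume 0 t ∧
    ∫ v in (0 : ℝ)..t, h v * Real.exp (-∫ w in (0 : ℝ)..v, h w)
      = 1 - Real.exp (-∫ w in (0 : ℝ)..t, h w) := by
  have hcont : ContinuousOn (fun v => ∫ w in (0 : ℝ)..v, h w) (Set.uIcc 0 t) :=
    intervalIntegral.continuousOn_primitive_interval' hi Set.left_mem_uIcc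
  have hexp : ContinuousOn (fun v => Real.exp (-∫ w in (0 : ℝ)..v, h w)) (Set.uIcc 0 t) :=
    hcont.neg.rexp
  have hint := hi.mul_continuousOn hexp
  refine ⟨hint, ?_⟩
  -- `-exp (-∫ h)` is continuous throughout and is an antiderivative wherever `h` is continuous,
  -- hence off `s`.
  rw [integral_eq_of_hasDerivAt_off_countable
    (fun v => -Real.exp (-∫ w in (0 : ℝ)..v, h w)) _ hs hexp.neg ?_ hint]
  · simp
    ring
  · rintro v ⟨hv, hvs⟩
    rw [min_eq_left ht, max_eq_right ht] at hv
    have hd : HasDerivAt (fun v => ∫ w in (0 : ℝ)..v, h w) (h v) v :=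
      intervalIntegral.integral_hasDerivAt_right
        (hi.mono_set (Set.uIcc_subset_uIcc_left (by
          rw [Set.uIcc_of_le ht]; exact ⟨hv.1.le, hv.2.le⟩)))
        hm.stronglyMeasurable.stronglyMeasurableAtFilter (hc v hv.1 hvs)
    convert! hd.fun_neg.exp.fun_neg using 1
    ring

end Polar

/-! ### Sublevel sets and measurability of the nearest marked distance -/

section Nearest

variable {Ω : Type*} {K : Ω → ℕ} {X : ℕ → Ω → Plane} {Z : ℕ → Set Ω} {u : Plane}

lemma markedInRange_eq_compl (t : ℝ) :
    markedInRange K X Z u t = (noMarkedIn K X Z (Metric.closedBall u t))ᶜ := by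
  ext ω
  simp [markedInRange, noMarkedIn]

lemma markedInRange_mono {s t : ℝ} (hst : s ≤ t) :
    markedInRange K X Z u s ⊆ markedInRange K X Z u t :=
  fun _ ⟨i, hi, hz, hd⟩ => ⟨i, hi, hz, hd.trans hst⟩

lemma markedInRange_of_neg {t : ℝ} (ht : t < 0) : markedInRange K X Z u t = ∅ :=
  Set.eq_empty_of_forall_notMem fun _ ⟨_, _, _, hd⟩ => absurd (dist_nonneg.trans hd) (not_le.2 ht)

/-- The nearest marked point exists as soon as there is a marked point. -/
lemma nearestMarkedDist_le_iff {ω : Ω} (hω : ∃ i, i < K ω ∧ ω ∈ Z i) (t : ℝ) :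
    nearestMarkedDist K X Z u ω ≤ t ↔ ω ∈ markedInRange K X Z u t := by
  have hfin : {d : ℝ | ∃ i, i < K ω ∧ ω ∈ Z i ∧ d = dist (X i ω) u}.Finite := by
    refine ((Set.finite_Iio (K ω)).image fun i => dist (X i ω) u).subset ?_
    rintro d ⟨i, hi, -, rfl⟩
    exact ⟨i, hi, rfl⟩
  obtain ⟨i₀, hi₀, hz₀⟩ := hω
  constructor
  · intro h
    have hne : {d : ℝ | ∃ i, i < K ω ∧ ω ∈ Z i ∧ d = dist (X i ω) u}.Nonempty :=
      ⟨_, i₀, hi₀, hz₀, rfl⟩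
    obtain ⟨i, hi, hz, hd⟩ := hne.csInf_mem hfin
    exact ⟨i, hi, hz, hd ▸ h⟩
  · rintro ⟨i, hi, hz, hd⟩
    exact (csInf_le hfin.bddBelow ⟨i, hi, hz, rfl⟩).trans hd

/-- On the conditioning event the infimum is attained. This reduces the distribution function to
void probabilities of balls. -/
lemma markedInRange_inter_nearestMarkedDist_le (r₀ t : ℝ) :
    markedInRange K X Z u r₀ ∩ nearestMarkedDist K X Z u ⁻¹' Set.Iic t
      = markedInRange K X Z u (min t r₀) := by
  ext ω
  constructor
  · rintro ⟨h1, h2⟩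
    have hω : ∃ i, i < K ω ∧ ω ∈ Z i := h1.imp fun i h => ⟨h.1, h.2.1⟩
    rw [← nearestMarkedDist_le_iff hω] at h1 ⊢
    exact le_min h2 h1
  · intro h
    have hω : ∃ i, i < K ω ∧ ω ∈ Z i := h.imp fun i h => ⟨h.1, h.2.1⟩
    exact ⟨markedInRange_mono (min_le_right _ _) h, (nearestMarkedDist_le_iff hω t).2
      (markedInRange_mono (min_le_left _ _) h)⟩

variable [MeasurableSpace Ω]

lemma measurableSet_markedInRange (hK : Measurable K) (hX : ∀ i, Measurable (X i))
    (hZ : ∀ i, MeasurableSet (Z i)) (t : ℝ) : MeasurableSet (markedInRange K X Z u t) := by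
  rw [markedInRange_eq_compl]
  exact (measurableSet_noMarkedIn hK hX hZ measurableSet_closedBall).compl

lemma measurable_nearestMarkedDist (hK : Measurable K) (hX : ∀ i, Measurable (X i))
    (hZ : ∀ i, MeasurableSet (Z i)) : Measurable (nearestMarkedDist K X Z u) := by
  refine measurable_of_Iic fun t => ?_
  have hno := measurableSet_noMarkedIn hK hX hZ (MeasurableSet.univ (α := Plane))
  -- Without marked points the distance is `sInf ∅ = 0`, which accounts for the second piece.
  have hset : nearestMarkedDist K X Z u ⁻¹' Set.Iic t
      = markedInRange K X Z u t ∪ (noMarkedIn K X Z Set.univ ∩ {_ω | 0 ≤ t}) := by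
    ext ω
    by_cases hω : ∃ i, i < K ω ∧ ω ∈ Z i
    · have : ω ∉ noMarkedIn K X Z Set.univ := by
        obtain ⟨i, hi, hz⟩ := hω
        exact fun h => h i hi hz (Set.mem_univ _)
      rw [Set.mem_preimage, Set.mem_Iic, nearestMarkedDist_le_iff hω]
      simp [this]
    · have h1 : ω ∉ markedInRange K X Z u t := fun h => hω (h.imp fun i h => ⟨h.1, h.2.1⟩)
      have h2 : ω ∈ noMarkedIn K X Z Set.univ := fun i hi hz => (hω ⟨i, hi, hz⟩).elim
      have h3 : {d : ℝ | ∃ i, i < K ω ∧ ω ∈ Z i ∧ d = dist (X i ω) u} = ∅ :=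
        Set.eq_empty_of_forall_notMem fun _ ⟨i, hi, hz, _⟩ => hω ⟨i, hi, hz⟩
      rw [Set.mem_preimage, Set.mem_Iic, nearestMarkedDist, h3, Real.sInf_empty]
      simp [h1, h2]
  rw [hset]
  exact (measurableSet_markedInRange hK hX hZ t).union (hno.inter (MeasurableSet.const _))

end Nearest

/-! ### The closed formulas through the circle length -/

section Formulas

lemma pB_mem_Icc {lam rB : ℝ} (hlam : 0 ≤ lam) (hrB : 0 ≤ rB) (l : ℝ) :
    pB lam rB l ∈ Set.Icc (0 : ℝ) 1 := by
  have h : -lam * max (l - rB) 0 * rB ≤ 0 := by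
    have : 0 ≤ lam * max (l - rB) 0 * rB :=
      mul_nonneg (mul_nonneg hlam (le_max_right _ _)) hrB
    linarith
  have := Real.exp_le_one_iff.2 h
  have := Real.exp_pos (-lam * max (l - rB) 0 * rB)
  rw [pB]
  constructor <;> linarith

lemma pB_pos {lam rB l : ℝ} (hlam : 0 < lam) (hrB : 0 < rB) (hl : rB < l) :
    0 < pB lam rB l := by
  rw [pB, sub_pos, Real.exp_lt_one_iff]
  have : 0 < lam * max (l - rB) 0 * rB :=
    mul_pos (mul_pos hlam (lt_max_of_lt_left (by linarith))) hrB
  linarith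

lemma continuous_pB (lam rB : ℝ) : Continuous (pB lam rB) := by
  unfold pB
  fun_prop

variable {R : ℝ} {u : Plane} {p : ℝ → ℝ}

lemma integral_circleLength_of_le {l : ℝ} (hl0 : 0 ≤ l) (hl : l ≤ R - ‖u‖) :
    ∫ v in (0 : ℝ)..l, circleLengthInDisc R v u * p v
      = 2 * Real.pi * ∫ v in (0 : ℝ)..l, v * p v := by
  rw [← intervalIntegral.integral_const_mul]
  refine intervalIntegral.integral_congr fun v hv => ?_
  rw [Set.uIcc_of_le hl0] at hv
  rw [circleLengthInDisc_of_le hv.1 (hv.2.trans hl)]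
  ring

lemma integral_circleLength_of_ge (hu : ‖u‖ ≤ R) (hp : Measurable p)
    (hp01 : ∀ v, p v ∈ Set.Icc (0 : ℝ) 1) {l : ℝ} (hl : R - ‖u‖ ≤ l) :
    ∫ v in (0 : ℝ)..l, circleLengthInDisc R v u * p v
      = 2 * Real.pi * (∫ v in (0 : ℝ)..(R - ‖u‖), v * p v)
        + ∫ v in (R - ‖u‖)..l, arcC R v ‖u‖ * p v := by
  have hR : 0 ≤ R := (norm_nonneg u).trans hu
  have h0 : 0 ≤ R - ‖u‖ := by linarith
  rw [← integral_circleLength_of_le h0 le_rfl, ← intervalIntegral.integral_add_adjacent_intervals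
    (intervalIntegrable_circleLength_mul hR u hp hp01 le_rfl h0)
    (intervalIntegrable_circleLength_mul hR u hp hp01 h0 (h0.trans hl))]
  congr 1
  refine intervalIntegral.integral_congr_ae (Filter.Eventually.of_forall fun v hv => ?_)
  rw [Set.uIoc_of_le hl] at hv
  rw [arcC_eq_circleLengthInDisc hu hv.1]

lemma BN_eq (hu : ‖u‖ ≤ R) (hp : Measurable p) (hp01 : ∀ v, p v ∈ Set.Icc (0 : ℝ) 1)
    {lb r₀ : ℝ} (hr₀ : 0 ≤ r₀) :
    BN lb R r₀ p ‖u‖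
      = 1 - Real.exp (-(lb * ∫ v in (0 : ℝ)..r₀, circleLengthInDisc R v u * p v)) := by
  rw [BN]
  split_ifs with h
  · rw [integral_circleLength_of_le hr₀ (by linarith)]
    ring_nf
  · rw [integral_circleLength_of_ge hu hp hp01 (by linarith)]

lemma fN_eq (hu : ‖u‖ ≤ R) (hp : Measurable p) (hp01 : ∀ v, p v ∈ Set.Icc (0 : ℝ) 1)
    {lb r₀ l : ℝ} (hl : l ∈ Set.Icc 0 r₀) :
    fN lb R r₀ p l ‖u‖ = lb * (circleLengthInDisc R l u * p l)
      * Real.exp (-(lb * ∫ v in (0 : ℝ)..l, circleLengthInDisc R v u * p v))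
      / BN lb R r₀ p ‖u‖ := by
  rw [fN]
  split_ifs with h
  -- Since `l ≤ r₀`, either alternative puts `l` in the range of full circles.
  · have hlR : l ≤ R - ‖u‖ := h.elim (fun h => by linarith [hl.2]) id
    rw [integral_circleLength_of_le hl.1 hlR, circleLengthInDisc_of_le hl.1 hlR]
    ring_nf
  · push Not at h
    rw [integral_circleLength_of_ge hu hp hp01 h.2.le, arcC_eq_circleLengthInDisc hu h.2]
    ring_nf

/-- Both factors are positive on `(rB, min r₀ R)`: blockage starts beyond `rB`, and a circle of
radius below `R` around a point of the disc meets it in positive length. This makes `B_N` positive,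
so the conditioning is legitimate. -/
lemma integral_circleLength_pB_pos (hu : ‖u‖ ≤ R) {lam rB r₀ : ℝ} (hlam : 0 < lam)
    (hrB : 0 < rB) (hrBr₀ : rB < r₀) (hrBR : rB < R) :
    0 < ∫ v in (0 : ℝ)..r₀, circleLengthInDisc R v u * pB lam rB v := by
  have hR : 0 ≤ R := (norm_nonneg u).trans hu
  have hp01 := pB_mem_Icc hlam.le hrB.le
  have hi := fun {a b : ℝ} (ha : 0 ≤ a) (hb : 0 ≤ b) => intervalIntegrable_circleLength_mul hR u
    (continuous_pB lam rB).measurable hp01 ha hb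
  have hb : rB < min r₀ R := lt_min hrBr₀ hrBR
  have hpos : 0 < ∫ v in rB..(min r₀ R), circleLengthInDisc R v u * pB lam rB v := by
    refine intervalIntegral.intervalIntegral_pos_of_pos_on (hi hrB.le (hrB.trans hb).le)
      (fun v hv => ?_) hb
    exact mul_pos (circleLengthInDisc_pos hu (hrB.trans hv.1)
      (by linarith [hv.2, min_le_right r₀ R, norm_nonneg u])) (pB_pos hlam hrB hv.1)
  refine hpos.trans_le (intervalIntegral.integral_mono_interval hrB.le hb.le (min_le_left _ _) ?_
    (hi le_rfl (hrB.trans hrBr₀).le))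
  refine (ae_restrict_iff' measurableSet_Ioc).2 (Filter.Eventually.of_forall fun v hv => ?_)
  exact mul_nonneg (circleLengthInDisc_mem_Icc hv.1.le u).1 (hp01 v).1

end Formulas

/-! ### The conditional law of the nearest marked distance -/

section Law

variable {Ω : Type*} [MeasurableSpace Ω] {P : Measure Ω} [IsProbabilityMeasure P]
  {K : Ω → ℕ} {X : ℕ → Ω → Plane} {Z : ℕ → Set Ω} {u : Plane} {lb R : ℝ} {p : ℝ → ℝ}

/-- The probability of a marked point within distance `t` of `u`. -/
lemma measure_markedInRange (hR : 0 ≤ R) (hlb : 0 ≤ lb)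
    (hX : IsPoissonPointProcess K X
      (ENNReal.ofReal lb • volume.restrict (Metric.closedBall 0 R)) P)
    (hZ : IsIndependentMarking K X Z (fun x => p (dist x u)) P)
    (hp : Measurable p) (hp01 : ∀ v, p v ∈ Set.Icc (0 : ℝ) 1) {t : ℝ} (ht : 0 ≤ t) :
    P (markedInRange K X Z u t) = ENNReal.ofReal
      (1 - Real.exp (-(lb * ∫ v in (0 : ℝ)..t, circleLengthInDisc R v u * p v))) := by
  have hfin : IsFiniteMeasure (volume.restrict (Metric.closedBall (0 : Plane) R)) :=
    ⟨by simpa using measure_closedBall_lt_top (μ := volume) (x := (0 : Plane)) (r := R)⟩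
  have hfin' : IsFiniteMeasure
      (ENNReal.ofReal lb • volume.restrict (Metric.closedBall (0 : Plane) R)) :=
    Measure.smul_finite _ ENNReal.ofReal_ne_top
  have hm := measurableSet_noMarkedIn hX.measurable_num hX.measurable_point
    hZ.measurableSet_mark (measurableSet_closedBall (x := u) (ε := t))
  rw [← integral_ball_disc hR hlb ht u hp hp01, markedInRange_eq_compl,
    ← hX.measureReal_noMarkedIn hZ (hp.comp (by fun_prop)) (fun x => hp01 _)
      measurableSet_closedBall, ← probReal_compl_eq_one_sub hm, ofReal_measureReal]

/-- Finite measures on the line are determined by their values on half-lines `(-∞, t]`. For `t ≥ 0`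
both sides equal `(1 - exp (-∫ h)) / B_N`, with the integral up to `min t r₀`. -/
lemma map_nearestMarkedDist_cond (hu : ‖u‖ ≤ R) (hlb : 0 ≤ lb)
    (hX : IsPoissonPointProcess K X
      (ENNReal.ofReal lb • volume.restrict (Metric.closedBall 0 R)) P)
    (hZ : IsIndependentMarking K X Z (fun x => p (dist x u)) P)
    (hp : Continuous p) (hp01 : ∀ v, p v ∈ Set.Icc (0 : ℝ) 1) {r₀ : ℝ} (hr₀ : 0 ≤ r₀)
    (hpos : 0 < BN lb R r₀ p ‖u‖) :
    Measure.map (nearestMarkedDist K X Z u) (cond P (markedInRange K X Z u r₀))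
      = (volume.restrict (Set.Icc 0 r₀)).withDensity
        fun l => ENNReal.ofReal (fN lb R r₀ p l ‖u‖) := by
  have hR : 0 ≤ R := (norm_nonneg u).trans hu
  have hD := measurable_nearestMarkedDist (u := u) hX.measurable_num hX.measurable_point
    hZ.measurableSet_mark
  have hA := measurableSet_markedInRange (u := u) hX.measurable_num hX.measurable_point
    hZ.measurableSet_mark r₀
  have hfin := Measure.isFiniteMeasure_map (cond P (markedInRange K X Z u r₀))
    (nearestMarkedDist K X Z u)
  refine Measure.ext_of_Iic _ _ fun t => ?_
  rw [Measure.map_apply hD measurableSet_Iic, cond_apply hA,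
    markedInRange_inter_nearestMarkedDist_le, withDensity_apply _ measurableSet_Iic,
    Measure.restrict_restrict measurableSet_Iic]
  rcases lt_or_ge t 0 with ht | ht
  · have hempty : Set.Iic t ∩ Set.Icc 0 r₀ = ∅ :=
      Set.eq_empty_of_forall_notMem fun x hx => by
        have := Set.mem_Iic.1 hx.1
        linarith [hx.2.1]
    rw [markedInRange_of_neg ((min_le_left _ _).trans_lt ht), hempty]
    simp
  · have hs : 0 ≤ min t r₀ := le_min ht hr₀
    have hinter : Set.Iic t ∩ Set.Icc 0 r₀ = Set.Icc 0 (min t r₀) := by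
      ext x
      simp only [Set.mem_inter_iff, Set.mem_Iic, Set.mem_Icc, le_min_iff]
      tauto
    set c : ℝ → ℝ := fun v => lb * (circleLengthInDisc R v u * p v) with hc
    have hprim : ∀ v, lb * ∫ w in (0 : ℝ)..v, circleLengthInDisc R w u * p w
        = ∫ w in (0 : ℝ)..v, c w := fun v => (intervalIntegral.integral_const_mul _ _).symm
    -- The exceptional set consists of the radii of internal and external tangency.
    obtain ⟨hint, heq⟩ := integral_mul_exp_neg_primitive (h := c) (t := min t r₀)
      (s := {R - ‖u‖, R + ‖u‖}) (Set.toFinite _).countable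
      (((measurable_circleLengthInDisc hR u).mul hp.measurable).const_mul lb)
      ((intervalIntegrable_circleLength_mul hR u hp.measurable hp01 le_rfl hs).const_mul lb) hs
      (fun v hv hvs => by
        simp only [Set.mem_insert_iff, Set.mem_singleton_iff, not_or] at hvs
        exact ((continuousAt_circleLengthInDisc hu hv hvs.1 hvs.2).mul
          hp.continuousAt).const_mul lb)
    have hf : ∀ l ∈ Set.Icc 0 (min t r₀), ENNReal.ofReal (fN lb R r₀ p l ‖u‖)
        = ENNReal.ofReal (BN lb R r₀ p ‖u‖)⁻¹
          * ENNReal.ofReal (c l * Real.exp (-∫ w in (0 : ℝ)..l, c w)) := fun l hl => by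
      rw [fN_eq hu hp.measurable hp01 ⟨hl.1, hl.2.trans (min_le_right _ _)⟩, hprim,
        ← ENNReal.ofReal_mul (inv_nonneg.2 hpos.le), div_eq_inv_mul]
    rw [hinter, setLIntegral_congr_fun measurableSet_Icc hf,
      lintegral_const_mul' _ _ ENNReal.ofReal_ne_top,
      measure_markedInRange hR hlb hX hZ hp.measurable hp01 hs,
      measure_markedInRange hR hlb hX hZ hp.measurable hp01 hr₀, ← BN_eq hu hp.measurable hp01 hr₀,
      ENNReal.ofReal_inv_of_pos hpos, hprim, ← heq, intervalIntegral.integral_of_le hs,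
      ← Measure.restrict_congr_set Ioc_ae_eq_Icc]
    congr 1
    refine ofReal_integral_eq_lintegral_ofReal
      ((intervalIntegrable_iff_integrableOn_Ioc_of_le hs).1 hint) ?_
    refine (ae_restrict_iff' measurableSet_Ioc).2 (Filter.Eventually.of_forall fun v hv => ?_)
    exact mul_nonneg (mul_nonneg hlb (mul_nonneg (circleLengthInDisc_mem_Icc hv.1.le u).1
      (hp01 v).1)) (Real.exp_pos _).le

end Law

end MmWave

theorem proposition2
    {Ω : Type*} [MeasurableSpace Ω] (P : MeasureTheory.Measure Ω)
    [MeasureTheory.IsProbabilityMeasure P]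
    (lb lu le rB r₀ R r : ℝ)
    (hlb : 0 < lb) (hlu : 0 ≤ lu) (hle : 0 ≤ le)
    (hrB : 0 < rB) (hrBr₀ : rB < r₀) (hrBR : rB < R) (hrR : r ≤ R)
    -- the user, at distance `r` from the origin
    (u : MmWave.Plane) (hu : ‖u‖ = r)
    -- the base stations `X i`, `i < K`: a Poisson process of density `lb` on the disc
    (K : Ω → ℕ) (X : ℕ → Ω → MmWave.Plane)
    (hX : MmWave.IsPoissonPointProcess K X
      (ENNReal.ofReal lb • MeasureTheory.volume.restrict (Metric.closedBall 0 R)) P)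
    -- `Z i` is the event that the link to the `i`-th base station is NLOS
    (Z : ℕ → Set Ω)
    (hZ : MmWave.IsIndependentMarking K X Z
      (fun x => MmWave.pB (lb + lu + le) rB (dist x u)) P) :
    -- `B_N` is the probability of at least one NLOS base station within range
    0 < MmWave.BN lb R r₀ (MmWave.pB (lb + lu + le) rB) r ∧
    P (MmWave.markedInRange K X Z u r₀) =
      ENNReal.ofReal (MmWave.BN lb R r₀ (MmWave.pB (lb + lu + le) rB) r) ∧
    -- given that event, the distance to the nearest NLOS base station has density `f_N`
    (∀ l ∈ Set.Icc 0 r₀, 0 ≤ MmWave.fN lb R r₀ (MmWave.pB (lb + lu + le) rB) l r) ∧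
    MeasureTheory.Measure.map (MmWave.nearestMarkedDist K X Z u)
        (ProbabilityTheory.cond P (MmWave.markedInRange K X Z u r₀)) =
      (MeasureTheory.volume.restrict (Set.Icc 0 r₀)).withDensity
        (fun l => ENNReal.ofReal (MmWave.fN lb R r₀ (MmWave.pB (lb + lu + le) rB) l r)) ∧
    -- `C(l, r)` is the length of the part of the circle of radius `l` that lies in the disc
    (∀ l, R - r < l → MmWave.arcC R l r = MmWave.circleLengthInDisc R l u) ∧
    (∀ l, R - r < l → l < R + r → 1 + MmWave.m₁ R l r * MmWave.m₂ R l r ≠ 0 →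
      Real.tan (MmWave.arcAngle R l r) =
        (MmWave.m₁ R l r - MmWave.m₂ R l r) / (1 + MmWave.m₁ R l r * MmWave.m₂ R l r)) := by
  subst hu
  have hlam : 0 < lb + lu + le := by linarith
  have hr₀ : 0 ≤ r₀ := (hrB.trans hrBr₀).le
  have hR : 0 ≤ R := (norm_nonneg u).trans hrR
  have hp := MmWave.continuous_pB (lb + lu + le) rB
  have hp01 := MmWave.pB_mem_Icc hlam.le hrB.le
  have hpos : 0 < MmWave.BN lb R r₀ (MmWave.pB (lb + lu + le) rB) ‖u‖ := by
    rw [MmWave.BN_eq hrR hp.measurable hp01 hr₀, sub_pos, Real.exp_lt_one_iff, neg_lt_zero]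
    exact mul_pos hlb (MmWave.integral_circleLength_pB_pos hrR hlam hrB hrBr₀ hrBR)
  refine ⟨hpos, ?_, fun l hl => ?_,
    MmWave.map_nearestMarkedDist_cond hrR hlb.le hX hZ hp hp01 hr₀ hpos,
    fun l hl => MmWave.arcC_eq_circleLengthInDisc hrR hl,
    fun l _ hl _ => MmWave.tan_arcAngle hl⟩
  · rw [MmWave.BN_eq hrR hp.measurable hp01 hr₀]
    exact MmWave.measure_markedInRange hR hlb.le hX hZ hp.measurable hp01 hr₀
  · rw [MmWave.fN_eq hrR hp.measurable hp01 hl]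
    exact div_nonneg (mul_nonneg (mul_nonneg hlb.le (mul_nonneg
      (MmWave.circleLengthInDisc_mem_Icc hl.1 u).1 (hp01 l).1)) (Real.exp_pos _).le) hpos.le
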